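/- Let $\mathcal T_0$ be an arbitrary finite tree with $|\mathcal T_0|\ge 2$ vertices. For $t\ge 1$ let $\mathcal T_t$ be obtained from $\mathcal T_{t-1}$ by the following operation $\Phi$: for each vertex $v$ of $\mathcal T_{t-1}$, insert one new vertex into each edge incident with $v$ (so each edge $uv$ receives two new vertices in total and becomes a path of three edges joining $u$ and $v$), and attach to $v$ as many new leaves as the degree of $v$ in $\mathcal T_{t-1}$. For a finite connected graph on a vertex set $\mathcal V$ with $|\mathcal V|\ge2$, let $P_{u\to v}(n)$ be the probability that simple random walk started at $u$ reaches $v$ for the first time after exactly $n$ steps, let $\mathcal P_{u\to v}(z)=\sum_{n\ge0}P_{u\to v}(n)z^n$, let $\mathcal H_{u\to v}=\mathcal P_{u\to v}'(1)$ be the hitting time, and let $$\langle\mathcal H\rangle=\frac{1}{|\mathcal V|(|\mathcal V|-1)}\sum_{u,v\in\mathcal V}\mathcal H_{u\to v}$$ be the mean hitting time. Let $\mathcal W=\frac12\sum_{u,v\in\mathcal V}d_{uv}$ be the Wiener index, where $d_{uv}$ is the graph distance. Write $\langle\mathcal H_t\rangle$ and $\mathcal W_t$ for these quantities on $\mathcal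 T_t$. Then for every $t\ge 0$: $\mathcal T_t$ is a tree with $|\mathcal T_t|=5^t(|\mathcal T_0|-1)+1$ vertices; for all vertices $u,v$ of $\mathcal T_t$ the series $\mathcal P_{u\to v}(z)$ converges for $z$ in a neighbourhood of $1$ and is differentiable at $z=1$; $$2\mathcal W_t=|\mathcal T_t|\,\langle\mathcal H_t\rangle ;$$ and $$\langle\mathcal H_t\rangle=\frac{2}{5^{t}(|\mathcal T_0|-1)+1}\left\{75^{t}\,\mathcal W_0-4\cdot5^{t}\left[\frac{15^{t}-5^{t}}{10}(|\mathcal T_0|-1)^{2}+\frac{15^{t}-1}{14}(|\mathcal T_0|-1)\right]\right\}.$$ Consequently $\langle\mathcal H_t\rangle$ scales as $|\mathcal T_t|^{\chi}$ with $\chi=1+\frac{\ln 3}{\ln 5}$: there is a constant $c>0$ (depending on $\mathcal T_0$) such that $\langle\mathcal H_t\rangle/|\mathcal T_t|^{\chi}\to c$ as $t\to\infty$. -/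

import Mathlib

open Filter Topology

universe u

namespace TreeWalk

noncomputable section

/-- The one-step probability of simple random walk: from `x`, each neighbour is chosen
with probability one over the degree of `x`. -/
def stepProb {V : Type u} [Fintype V] (G : SimpleGraph V) (x y : V) : ℝ :=
  open Classical in if G.Adj x y then 1 / (G.degree x : ℝ) else 0

/-- The probability that simple random walk started at `u` reaches `v` for the first time
after exactly `n` steps: the sum, over all trajectories `x 0 = u, x 1, …, x n = v` that avoid `v`
before time `n`, of the product of the one-step probabilities. -/
def firstPassageProb {V : Type u} [Fintype V] (G : SimpleGraph V) (u v : V) (n : ℕ) : ℝ :=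
  open Classical in
  ∑ x : Fin (n + 1) → V with
      x 0 = u ∧ x (Fin.last n) = v ∧ ∀ i : Fin n, x i.castSucc ≠ v,
    ∏ i : Fin n, stepProb G (x i.castSucc) (x i.succ)

/-- The probability generating function of the first passage time from `u` to `v`. -/
def passageGenFun {V : Type u} [Fintype V] (G : SimpleGraph V) (u v : V) (z : ℝ) : ℝ :=
  ∑' n : ℕ, firstPassageProb G u v n * z ^ n

/-- The hitting time from `u` to `v`: the derivative at `1` of the generating function. -/
def hittingTime {V : Type u} [Fintype V] (G : SimpleGraph V) (u v : V) : ℝ :=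
  deriv (passageGenFun G u v) 1

/-- The mean hitting time over all ordered pairs of vertices. -/
def meanHittingTime {V : Type u} [Fintype V] (G : SimpleGraph V) : ℝ :=
  1 / ((Fintype.card V : ℝ) * ((Fintype.card V : ℝ) - 1)) * ∑ u : V, ∑ v : V, hittingTime G u v

/-- The Wiener index: half the sum of the distances over all ordered pairs of vertices. -/
def wienerIndex {V : Type u} [Fintype V] (G : SimpleGraph V) : ℝ :=
  1 / 2 * ∑ u : V, ∑ v : V, (G.dist u v : ℝ)

/-- A finite graph bundled with its vertex type (which changes along the growth process). -/
structure FiniteGraph : Type (u + 1) where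
  V : Type u
  fintype : Fintype V
  graph : SimpleGraph V

attribute [instance] FiniteGraph.fintype

/-- The vertices after one growth step: the old vertices, then for each vertex `v` and each edge at
`v` (that is, for each dart with first vertex `v`) one vertex inserted into that edge, and
then for each vertex `v` as many leaves as the degree of `v`, again labelled by the darts
with first vertex `v`. -/
abbrev GrowVert {V : Type u} (G : SimpleGraph V) : Type u := V ⊕ G.Dart ⊕ G.Dart

/-- The edges after one growth step, each listed in one orientation or both. The two
vertices inserted into the edge `v w` are those of the dart `(v, w)`, next to `v`, and of the
reversed dart `(w, v)`, next to `w`; so `v w` becomes a path with three edges. -/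
def growRel {V : Type u} (G : SimpleGraph V) : GrowVert G → GrowVert G → Prop
  | Sum.inl v, Sum.inr (Sum.inl d) => d.fst = v
  | Sum.inr (Sum.inl d), Sum.inr (Sum.inl e) => e = d.symm
  | Sum.inl v, Sum.inr (Sum.inr d) => d.fst = v
  | _, _ => False

/-- One growth step on graphs. -/
def growGraph {V : Type u} (G : SimpleGraph V) : SimpleGraph (GrowVert G) :=
  SimpleGraph.fromRel (growRel G)

/-- One growth step on bundled finite graphs. -/
def grow (T : FiniteGraph.{u}) : FiniteGraph.{u} where
  V := GrowVert T.graph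
  fintype := open Classical in inferInstance
  graph := growGraph T.graph

/-- The network after `t` growth steps, starting from the seed `G`. -/
def grownTree {V : Type u} [hV : Fintype V] (G : SimpleGraph V) : ℕ → FiniteGraph.{u}
  | 0 => ⟨V, hV, G⟩
  | t + 1 => grow (grownTree G t)

/-- The order of the network after `t` growth steps. -/
def order {V : Type u} [Fintype V] (G : SimpleGraph V) (t : ℕ) : ℕ :=
  Fintype.card (grownTree G t).V

end

end TreeWalk

/-! Everything is driven by the Laplacian. In a tree, each vertex u ≠ x has exactly one neighbour
closer to x, so the Laplacian of d(·, x) is deg − 2 plus a point mass 2 at x (`laplacian_dist`). On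
a finite connected graph a function is determined by its Laplacian and one value, so this equation
characterises the distance.

Hitting times: H(u→v) = Σ_x deg(x)/2 · (d(u,v) + d(x,v) − d(u,x)) is nonnegative and solves the
one-step equations (`isHittingFunction_treeHitting`). Any such solution forces geometric decay of
the first passage probabilities, hence convergence beyond z = 1, and the equations have no other
solution. Summing over u, v, where the degrees add up to 2(N − 1), gives 2W = N⟨H⟩.

Growth: the distance in the grown tree is three times a bilinear interpolation of the old one, plus
an offset at new leaves, minus a correction for pairs on one edge; it is verified by its Laplacian
(`dist_growGraph`). Summation by parts evaluates the degree-weighted distance sums, so with E = N −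
1 one step sends W to 75W − 20(E² + E) and E to 5E. Solving this recursion gives the closed form.
After division by 15^t, the limit of ⟨H⟩ is positive because W₀ ≥ E₀². -/

namespace TreeWalk

noncomputable section

open scoped Classical

/-! ### The graph Laplacian and uniqueness for its equation -/

section Laplacian

variable {V : Type u} [Fintype V] (G : SimpleGraph V)

/-- The degree of a vertex as a real number. -/
def realDegree (x : V) : ℝ := ∑ y, if G.Adj x y then 1 else 0

/-- The sum of the increments of a function along the edges at a vertex. -/
def laplacian (f : V → ℝ) (x : V) : ℝ := ∑ y, if G.Adj x y then f y - f x else 0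

theorem realDegree_eq (x : V) [Fintype (G.neighborSet x)] : realDegree G x = G.degree x := by
  rw [realDegree, Finset.sum_boole, ← SimpleGraph.card_neighborFinset_eq_degree]
  congr 2
  ext y
  simp

theorem sum_realDegree : ∑ x, realDegree G x = 2 * (Nat.card G.edgeSet : ℝ) := by
  have h := G.sum_degrees_eq_twice_card_edges
  have h2 : Nat.card G.edgeSet = G.edgeFinset.card := by
    rw [Nat.card_eq_fintype_card, SimpleGraph.edgeFinset_card]
  rw [h2]
  simp only [realDegree_eq]
  exact_mod_cast h

theorem sum_dart [Fintype G.Dart] (F : V → V → ℝ) :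
    ∑ d : G.Dart, F d.fst d.snd = ∑ x, ∑ y, if G.Adj x y then F x y else 0 := by
  rw [← Fintype.sum_prod_type' (f := fun x y => if G.Adj x y then F x y else 0),
    ← Finset.sum_filter]
  refine Finset.sum_bij (fun d _ => d.toProd) ?_ ?_ ?_ ?_
  · intro d _
    simp
  · intro d _ e _ h
    exact SimpleGraph.Dart.ext _ _ h
  · intro p hp
    exact ⟨⟨p, by simpa using hp⟩, Finset.mem_univ _, rfl⟩
  · intro d _
    rfl

theorem laplacian_add (f g : V → ℝ) (x : V) :
    laplacian G (fun y => f y + g y) x = laplacian G f x + laplacian G g x := by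
  simp only [laplacian, ← Finset.sum_add_distrib]
  refine Finset.sum_congr rfl fun y _ => ?_
  split_ifs <;> ring

theorem laplacian_sub (f g : V → ℝ) (x : V) :
    laplacian G (fun y => f y - g y) x = laplacian G f x - laplacian G g x := by
  simp only [laplacian, ← Finset.sum_sub_distrib]
  refine Finset.sum_congr rfl fun y _ => ?_
  split_ifs <;> ring

theorem laplacian_const_mul (c : ℝ) (f : V → ℝ) (x : V) :
    laplacian G (fun y => c * f y) x = c * laplacian G f x := by
  simp only [laplacian, Finset.mul_sum]
  refine Finset.sum_congr rfl fun y _ => ?_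
  split_ifs <;> ring

theorem laplacian_sum {ι : Type*} (s : Finset ι) (f : ι → V → ℝ) (x : V) :
    laplacian G (fun y => ∑ i ∈ s, f i y) x = ∑ i ∈ s, laplacian G (f i) x := by
  simp only [laplacian]
  rw [Finset.sum_comm]
  refine Finset.sum_congr rfl fun y _ => ?_
  split_ifs <;> simp

theorem sum_adj_swap (F : V → V → ℝ) :
    (∑ x, ∑ y, if G.Adj x y then F x y else 0) = ∑ x, ∑ y, if G.Adj x y then F y x else 0 := by
  rw [Finset.sum_comm]
  simp only [G.adj_comm]

/-- Summation by parts. -/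
theorem sum_mul_laplacian (f : V → ℝ) :
    ∑ x, f x * laplacian G f x =
      -(1 / 2) * ∑ x, ∑ y, if G.Adj x y then (f y - f x) ^ 2 else 0 := by
  have h1 : ∑ x, f x * laplacian G f x =
      ∑ x, ∑ y, if G.Adj x y then f x * (f y - f x) else 0 := by
    simp only [laplacian, Finset.mul_sum, mul_ite, mul_zero]
  have h2 := sum_adj_swap G fun x y => f x * (f y - f x)
  have h3 : (∑ x, ∑ y, if G.Adj x y then (f y - f x) ^ 2 else 0) =
      -(∑ x, ∑ y, if G.Adj x y then f x * (f y - f x) else 0)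
      - ∑ x, ∑ y, if G.Adj x y then f y * (f x - f y) else 0 := by
    simp only [← Finset.sum_neg_distrib, ← Finset.sum_sub_distrib]
    refine Finset.sum_congr rfl fun x _ => Finset.sum_congr rfl fun y _ => ?_
    split_ifs <;> ring
  rw [h1, h3, ← h2]
  ring

variable {G}

/-- A harmonic function on a finite connected graph is constant. -/
theorem eq_of_laplacian_eq_zero (hG : G.Connected) {f : V → ℝ}
    (hf : ∀ x, laplacian G f x = 0) (x y : V) : f x = f y := by
  -- Pairing f with its zero Laplacian makes the Dirichlet energy vanish, so every edge increment is
  -- zero.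
  have h := sum_mul_laplacian G f
  simp only [hf, mul_zero, Finset.sum_const_zero] at h
  have h0 : (∑ x, ∑ y, if G.Adj x y then (f y - f x) ^ 2 else 0) = 0 := by linarith
  have hadj : ∀ x y, G.Adj x y → f x = f y := by
    intro x y hxy
    have hnn : ∀ x y, 0 ≤ if G.Adj x y then (f y - f x) ^ 2 else 0 := by
      intro x y
      split_ifs <;> positivity
    have h1 := (Finset.sum_eq_zero_iff_of_nonneg
      (fun x _ => Finset.sum_nonneg fun y _ => hnn x y)).1 h0 x (Finset.mem_univ _)
    have h2 := (Finset.sum_eq_zero_iff_of_nonneg (fun y _ => hnn x y)).1 h1 y (Finset.mem_univ _)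
    rw [if_pos hxy] at h2
    have := pow_eq_zero_iff (two_ne_zero) |>.1 h2
    linarith
  obtain ⟨p⟩ := hG x y
  induction p with
  | nil => rfl
  | cons h _ ih => exact (hadj _ _ h).trans ih

theorem eq_of_laplacian_eq (hG : G.Connected) {f g : V → ℝ}
    (h : ∀ x, laplacian G f x = laplacian G g x) (x₀ : V) (h0 : f x₀ = g x₀) (x : V) :
    f x = g x := by
  have := eq_of_laplacian_eq_zero hG (f := fun y => f y - g y)
    (fun x => by rw [laplacian_sub, h, sub_self]) x x₀
  linarith

end Laplacian

/-! ### Geodesics in trees -/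

section Distance

variable {V : Type u} {G : SimpleGraph V}

theorem exists_adj_dist_succ_eq (hG : G.Connected) {u x : V} (hux : u ≠ x) :
    ∃ w, G.Adj u w ∧ G.dist w x + 1 = G.dist u x := by
  obtain ⟨p, hp⟩ := hG.exists_walk_length_eq_dist u x
  cases p with
  | nil => exact absurd rfl hux
  | @cons _ w _ h q =>
    refine ⟨w, h, ?_⟩
    have h1 := SimpleGraph.dist_le q
    have h2 := hG.dist_triangle (u := u) (v := w) (w := x)
    have h3 := SimpleGraph.dist_eq_one_iff_adj.2 h
    simp only [SimpleGraph.Walk.length_cons] at hp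
    omega

/-- In a tree, a vertex has at most one neighbour closer to a given vertex. -/
theorem eq_of_adj_of_dist_succ_eq (hG : G.IsTree) {u x w w' : V} (hw : G.Adj u w)
    (hw' : G.Adj u w') (hd : G.dist w x + 1 = G.dist u x) (hd' : G.dist w' x + 1 = G.dist u x) :
    w = w' := by
  -- Each closer neighbour is the second vertex of a geodesic from u to x, and a tree has only one
  -- path.
  have key : ∀ z, G.Adj u z → G.dist z x + 1 = G.dist u x →
      ∃ p : G.Walk u x, p.IsPath ∧ p.snd = z := by
    intro z hz hzd
    obtain ⟨q, hq⟩ := hG.1.exists_walk_length_eq_dist z x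
    refine ⟨SimpleGraph.Walk.cons hz q, ?_, by simp⟩
    exact SimpleGraph.Walk.isPath_of_length_eq_dist _ (by simp [hq, hzd])
  obtain ⟨p, hp, rfl⟩ := key w hw hd
  obtain ⟨q, hq, rfl⟩ := key w' hw' hd'
  rw [(hG.existsUnique_path u x).unique hp hq]

end Distance

/-! ### Distance sums and the Wiener index of a tree -/

section Tree

variable {V : Type u} [Fintype V] {G : SimpleGraph V}

theorem card_eq_card_edgeSet_add_one (hG : G.IsTree) :
    (Fintype.card V : ℝ) = Nat.card G.edgeSet + 1 := by
  have := (SimpleGraph.isTree_iff_connected_and_card.1 hG).2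
  rw [← Nat.card_eq_fintype_card, ← this]
  push_cast
  rfl

/-- The Laplacian of the distance to a vertex in a tree. -/
theorem laplacian_dist (hG : G.IsTree) (x u : V) :
    laplacian G (fun y => (G.dist y x : ℝ)) u =
      realDegree G u - 2 + 2 * if u = x then 1 else 0 := by
  by_cases hux : u = x
  · subst hux
    simp only [laplacian, realDegree, if_true]
    rw [sub_add, show (2 : ℝ) - 2 * 1 = 0 by norm_num, sub_zero]
    refine Finset.sum_congr rfl fun y _ => ?_
    split_ifs with h
    · simp [SimpleGraph.dist_eq_one_iff_adj.2 h.symm]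
    · rfl
  · obtain ⟨w, hw, hd⟩ := exists_adj_dist_succ_eq hG.1 hux
    -- Every neighbour contributes +1 except the closer one, w, which contributes −1 = 1 − 2.
    have : realDegree G u - 2 + 2 * (if u = x then 1 else 0) =
        ∑ y, ((if G.Adj u y then (1 : ℝ) else 0) - if y = w then 2 else 0) := by
      rw [Finset.sum_sub_distrib, Finset.sum_ite_eq' Finset.univ w]
      simp [realDegree, hux]
    rw [this, laplacian]
    refine Finset.sum_congr rfl fun y _ => ?_
    by_cases hy : y = w
    · subst hy
      rw [if_pos hw, if_pos hw, if_pos rfl, ← hd]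
      push_cast
      ring
    · rw [if_neg hy]
      split_ifs with h
      · have h1 := hG.dist_eq_dist_add_one_of_adj x h
        rw [SimpleGraph.dist_comm (u := x), SimpleGraph.dist_comm (u := x)] at h1
        rcases h1 with h1 | h1
        · exact absurd (eq_of_adj_of_dist_succ_eq hG h hw h1.symm hd) hy
        · rw [h1]
          push_cast
          ring
      · simp

theorem sum_realDegree_of_isTree (hG : G.IsTree) :
    ∑ x, realDegree G x = 2 * ((Fintype.card V : ℝ) - 1) := by
  rw [sum_realDegree, card_eq_card_edgeSet_add_one hG]
  ring

/-- The degree-weighted sum of the distances to a vertex of a tree. -/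
theorem sum_realDegree_mul_dist (hG : G.IsTree) (x : V) :
    ∑ u, realDegree G u * (G.dist u x : ℝ) =
      2 * ∑ u, (G.dist u x : ℝ) - ((Fintype.card V : ℝ) - 1) := by
  have h := sum_mul_laplacian G fun y => (G.dist y x : ℝ)
  -- Along each edge the distance to x changes by ±1, so the energy of d(·, x) is just the sum of
  -- the degrees.
  have h1 : (∑ u, ∑ y, if G.Adj u y then ((G.dist y x : ℝ) - G.dist u x) ^ 2 else 0) =
      ∑ u, realDegree G u := by
    refine Finset.sum_congr rfl fun u _ => Finset.sum_congr rfl fun y _ => ?_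
    split_ifs with hy
    · have h1 := hG.dist_eq_dist_add_one_of_adj x hy
      rw [SimpleGraph.dist_comm (u := x), SimpleGraph.dist_comm (u := x)] at h1
      rcases h1 with h1 | h1 <;> rw [h1] <;> push_cast <;> ring
    · rfl
  rw [h1, sum_realDegree_of_isTree hG] at h
  have h2 : ∀ u, (G.dist u x : ℝ) * laplacian G (fun y => (G.dist y x : ℝ)) u =
      realDegree G u * (G.dist u x : ℝ) - 2 * (G.dist u x : ℝ) := by
    intro u
    rw [laplacian_dist hG]
    split_ifs with hux
    · simp [hux]
    · ring
  rw [Finset.sum_congr rfl fun u _ => h2 u, Finset.sum_sub_distrib, ← Finset.mul_sum] at h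
  linarith

theorem two_mul_wienerIndex : 2 * wienerIndex G = ∑ u, ∑ v, (G.dist u v : ℝ) := by
  rw [wienerIndex]
  ring

theorem sum_realDegree_dist (hG : G.IsTree) :
    ∑ x, ∑ u, realDegree G u * (G.dist u x : ℝ) =
      4 * wienerIndex G - (Fintype.card V : ℝ) * ((Fintype.card V : ℝ) - 1) := by
  have h : ∑ x, ∑ u, (G.dist u x : ℝ) = 2 * wienerIndex G := by
    rw [Finset.sum_comm, two_mul_wienerIndex]
  simp only [sum_realDegree_mul_dist hG, Finset.sum_sub_distrib, ← Finset.mul_sum, h]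
  simp
  ring

theorem sum_realDegree_realDegree_dist (hG : G.IsTree) :
    ∑ x, realDegree G x * ∑ u, realDegree G u * (G.dist u x : ℝ) =
      8 * wienerIndex G - 2 * (Fintype.card V : ℝ) * ((Fintype.card V : ℝ) - 1)
        - 2 * ((Fintype.card V : ℝ) - 1) ^ 2 := by
  have h : ∑ x, realDegree G x * ∑ u, (G.dist u x : ℝ) =
      4 * wienerIndex G - (Fintype.card V : ℝ) * ((Fintype.card V : ℝ) - 1) := by
    rw [← sum_realDegree_dist hG, Finset.sum_comm]
    refine Finset.sum_congr rfl fun x _ => ?_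
    rw [Finset.mul_sum]
    exact Finset.sum_congr rfl fun u _ => by rw [SimpleGraph.dist_comm]
  simp only [sum_realDegree_mul_dist hG, mul_sub, Finset.sum_sub_distrib, ← Finset.sum_mul,
    mul_left_comm _ (2 : ℝ), ← Finset.mul_sum, h, sum_realDegree_of_isTree hG]
  ring

/-- Distances are at least 2 off the diagonal and off the edges, and a tree has only N − 1 edges;
stars attain equality. This makes the limiting constant positive. -/
theorem sq_card_sub_one_le_wienerIndex (hG : G.IsTree) :
    ((Fintype.card V : ℝ) - 1) ^ 2 ≤ wienerIndex G := by
  have h : ∑ u, ∑ v, ((2 : ℝ) - (if G.Adj u v then 1 else 0) - if u = v then 2 else 0) ≤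
      2 * wienerIndex G := by
    rw [two_mul_wienerIndex]
    refine Finset.sum_le_sum fun u _ => Finset.sum_le_sum fun v _ => ?_
    by_cases huv : u = v
    · simp [huv]
    · by_cases ha : G.Adj u v
      · simp [huv, ha, SimpleGraph.dist_eq_one_iff_adj.2 ha]
        norm_num
      · have := hG.1.one_lt_dist_of_ne_of_not_adj huv ha
        simp only [ha, huv, if_false, sub_zero]
        exact_mod_cast this
  have h2 : ∑ u, ∑ v, ((2 : ℝ) - (if G.Adj u v then 1 else 0) - if u = v then 2 else 0) =
      2 * (Fintype.card V : ℝ) ^ 2 - 2 * ((Fintype.card V : ℝ) - 1)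
        - 2 * Fintype.card V := by
    simp only [Finset.sum_sub_distrib]
    rw [show (∑ x : V, ∑ y : V, if G.Adj x y then (1 : ℝ) else 0) = ∑ x, realDegree G x from rfl,
      sum_realDegree_of_isTree hG]
    simp
    ring
  nlinarith

end Tree

/-! ### First-step recursion for first passage probabilities -/

section FirstPassage

variable {V : Type u} [Fintype V] (G : SimpleGraph V)

theorem stepProb_eq (x y : V) :
    stepProb G x y = if G.Adj x y then 1 / realDegree G x else 0 := by
  rw [stepProb, realDegree_eq]

theorem stepProb_nonneg (x y : V) : 0 ≤ stepProb G x y := by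
  rw [stepProb]
  split_ifs <;> positivity

theorem firstPassageProb_nonneg (u v : V) (n : ℕ) : 0 ≤ firstPassageProb G u v n :=
  Finset.sum_nonneg fun _ _ => Finset.prod_nonneg fun _ _ => stepProb_nonneg G _ _

theorem firstPassageProb_zero (u v : V) :
    firstPassageProb G u v 0 = if u = v then 1 else 0 := by
  rw [firstPassageProb, Finset.sum_filter, ← (Equiv.funUnique (Fin 1) V).symm.sum_comp]
  simp only [Fin.prod_univ_zero]
  rw [Finset.sum_eq_single u]
  · simp [Equiv.funUnique, uniqueElim_const]
  · intro b _ hb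
    simp [Equiv.funUnique, hb]
  · simp

/-- Condition on the first step. A start at v already violates avoidance at time 0, whence the zero
branch. -/
theorem firstPassageProb_succ (u v : V) (n : ℕ) :
    firstPassageProb G u v (n + 1) =
      if u = v then 0 else ∑ w, stepProb G u w * firstPassageProb G w v n := by
  simp only [firstPassageProb, Finset.sum_filter, Finset.mul_sum]
  rw [← (Fin.consEquiv fun _ : Fin (n + 2) => V).sum_comp, Fintype.sum_prod_type,
    Finset.sum_comm]
  split_ifs with huv
  · refine Finset.sum_eq_zero fun y _ => Finset.sum_eq_zero fun a _ => if_neg ?_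
    rintro ⟨h0, -, h⟩
    exact h 0 (by simpa using h0.trans huv)
  · rw [Finset.sum_comm (s := Finset.univ) (t := (Finset.univ : Finset (Fin (n + 1) → V)))]
    refine Finset.sum_congr rfl fun y _ => ?_
    rw [Finset.sum_eq_single u, Finset.sum_eq_single (y 0)]
    · rw [Fin.prod_univ_succ]
      simp only [Fin.consEquiv, Equiv.coe_fn_mk, Fin.forall_fin_succ, Fin.castSucc_zero,
        Fin.cons_zero, Fin.cons_succ, ← Fin.succ_last, ← Fin.succ_castSucc, ne_eq, huv,
        not_false_eq_true, true_and, mul_ite, mul_zero]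
    · intro w _ hw
      rw [if_neg fun h => hw h.1.symm, mul_zero]
    · simp
    · intro a _ ha
      exact if_neg fun h => ha h.1
    · simp

theorem firstPassageProb_self_succ (v : V) (n : ℕ) : firstPassageProb G v v (n + 1) = 0 := by
  rw [firstPassageProb_succ, if_pos rfl]

end FirstPassage

/-! ### Generating functions controlled by a hitting function -/

section Decay

variable {V : Type u} [Fintype V] {G : SimpleGraph V} {v : V} {h : V → ℝ}

/-- Functions on the vertices which vanish at `v` and exceed their mean over the neighbours
by one at every other vertex. -/
structure IsHittingFunction (G : SimpleGraph V) (v : V) (h : V → ℝ) : Prop where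
  nonneg : ∀ u, 0 ≤ h u
  self : h v = 0
  step : ∀ u, u ≠ v → h u = 1 + ∑ w, stepProb G u w * h w

theorem IsHittingFunction.one_le (hh : IsHittingFunction G v h) {u : V} (hu : u ≠ v) :
    1 ≤ h u := by
  rw [hh.step u hu]
  have : 0 ≤ ∑ w, stepProb G u w * h w :=
    Finset.sum_nonneg fun w _ => mul_nonneg (stepProb_nonneg G u w) (hh.nonneg w)
  linarith

/-- A function which vanishes at `v` and is harmonic elsewhere vanishes. -/
theorem IsHittingFunction.eq_zero_of_harmonic (hh : IsHittingFunction G v h) {g : V → ℝ}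
    (hv : g v = 0) (hg : ∀ u, u ≠ v → g u = ∑ w, stepProb G u w * g w) (u : V) : g u = 0 := by
  by_cases hne : ∃ x, x ≠ v
  swap
  · push Not at hne
    rw [hne u, hv]
  obtain ⟨x₀, hx₀⟩ := hne
  -- Maximum principle relative to h: where |g|/h is maximal with value C, averaging gives C h ≤ C
  -- (h − 1), so C ≤ 0.
  obtain ⟨x, hx, hmax⟩ := Finset.exists_max_image (Finset.univ.filter fun x => x ≠ v)
    (fun x => |g x| / h x) ⟨x₀, by simpa using hx₀⟩
  simp only [Finset.mem_filter, Finset.mem_univ, true_and] at hx hmax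
  set C := |g x| / h x with hC
  have hbound : ∀ w, |g w| ≤ C * h w := by
    intro w
    by_cases hw : w = v
    · simp [hw, hv, hh.self]
    · exact (div_le_iff₀ (by linarith [hh.one_le hw])).1 (hmax w hw)
  have hxC : |g x| = C * h x := by
    rw [hC, div_mul_cancel₀]
    linarith [hh.one_le hx]
  have h1 : |g x| ≤ C * (h x - 1) := by
    calc |g x| = |∑ w, stepProb G x w * g w| := by rw [← hg x hx]
      _ ≤ ∑ w, |stepProb G x w * g w| := Finset.abs_sum_le_sum_abs _ _
      _ ≤ ∑ w, C * (stepProb G x w * h w) := Finset.sum_le_sum fun w _ => by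
          rw [abs_mul, abs_of_nonneg (stepProb_nonneg G x w), mul_left_comm]
          exact mul_le_mul_of_nonneg_left (hbound w) (stepProb_nonneg G x w)
      _ = C * (h x - 1) := by rw [← Finset.mul_sum, hh.step x hx]; ring
  have hC0 : C ≤ 0 := by linarith
  have h2 := (hbound u).trans (mul_nonpos_of_nonpos_of_nonneg hC0 (hh.nonneg u))
  exact abs_eq_zero.1 (le_antisymm h2 (abs_nonneg _))

/-- First passage probabilities decay geometrically. -/
theorem IsHittingFunction.exists_decay (hh : IsHittingFunction G v h) :
    ∃ r : ℝ, 0 < r ∧ r < 1 ∧ ∃ C : ℝ, 0 ≤ C ∧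
      ∀ u n, firstPassageProb G u v n ≤ C * r ^ n := by
  obtain ⟨M, hM⟩ := Finite.exists_le h
  -- The floor 2 keeps r = 1 − 1/K positive, since the final constant divides by r.
  set K := max M 2 with hK
  have hK2 : 2 ≤ K := le_max_right _ _
  have hKh : ∀ u, h u ≤ K := fun u => (hM u).trans (le_max_left _ _)
  set r := 1 - 1 / K with hr
  have hK1 : 1 / K ≤ 1 / 2 := one_div_le_one_div_of_le (by norm_num) hK2
  have hK0 : 0 < 1 / K := by positivity
  have hr0 : 0 < r := by linarith
  -- Away from v, averaging takes h to h − 1, and h ≤ K gives h − 1 ≤ r h; each step therefore gains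
  -- a factor r.
  have hdecay : ∀ n u, u ≠ v → firstPassageProb G u v (n + 1) ≤ r ^ n * h u := by
    intro n
    induction n with
    | zero =>
      intro u hu
      rw [firstPassageProb_succ, if_neg hu, pow_zero, one_mul]
      refine le_trans ?_ (hh.one_le hu)
      simp only [firstPassageProb_zero, mul_ite, mul_one, mul_zero, Finset.sum_ite_eq',
        Finset.mem_univ, if_true]
      rw [stepProb]
      split_ifs
      · exact div_le_one_of_le₀ (by
          have hpos : 0 < G.degree u := (G.degree_pos_iff_exists_adj u).2 ⟨v, by assumption⟩
          exact_mod_cast hpos) (by positivity)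
      · norm_num
    | succ n ih =>
      intro u hu
      rw [firstPassageProb_succ, if_neg hu]
      calc ∑ w, stepProb G u w * firstPassageProb G w v (n + 1)
          ≤ ∑ w, r ^ n * (stepProb G u w * h w) := Finset.sum_le_sum fun w _ => by
            rw [mul_left_comm]
            refine mul_le_mul_of_nonneg_left ?_ (stepProb_nonneg G u w)
            by_cases hw : w = v
            · rw [hw, firstPassageProb_self_succ, hh.self, mul_zero]
            · exact ih w hw
        _ = r ^ n * (h u - 1) := by rw [← Finset.mul_sum, hh.step u hu]; ring
        _ ≤ r ^ n * (r * h u) := by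
            refine mul_le_mul_of_nonneg_left ?_ (by positivity)
            have : 1 / K * h u ≤ 1 := by
              rw [one_div_mul_eq_div]
              exact div_le_one_of_le₀ (hKh u) (by linarith)
            rw [hr]
            linarith
        _ = r ^ (n + 1) * h u := by ring
  refine ⟨r, hr0, by linarith, K / r, by positivity, fun u n => ?_⟩
  have hC : 1 ≤ K / r := (one_le_div₀ hr0).2 (by linarith)
  cases n with
  | zero =>
    rw [firstPassageProb_zero, pow_zero, mul_one]
    split_ifs <;> linarith
  | succ n =>
    by_cases hu : u = v
    · rw [hu, firstPassageProb_self_succ]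
      positivity
    · calc firstPassageProb G u v (n + 1) ≤ r ^ n * h u := hdecay n u hu
        _ ≤ r ^ n * K := mul_le_mul_of_nonneg_left (hKh u) (by positivity)
        _ = K / r * r ^ (n + 1) := by rw [pow_succ]; field_simp

/-- Decay C r^n allows any R with 1 < R < 1/r; on that ball the differentiated series is dominated
by C n (rR)^n, so termwise differentiation is legitimate. -/
theorem IsHittingFunction.hasDerivAt_aux (hh : IsHittingFunction G v h) :
    ∃ R : ℝ, 1 < R ∧ ∀ u, ∀ z ∈ Metric.ball (0 : ℝ) R,
      (Summable fun n : ℕ => firstPassageProb G u v n * z ^ n) ∧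
      (Summable fun n : ℕ => firstPassageProb G u v n * (n * z ^ (n - 1))) ∧
      HasDerivAt (passageGenFun G u v)
        (∑' n : ℕ, firstPassageProb G u v n * (n * z ^ (n - 1))) z := by
  obtain ⟨r, hr0, hr1, C, hC, hdecay⟩ := hh.exists_decay
  obtain ⟨R, hR1, hR2⟩ := exists_between ((one_lt_inv₀ hr0).2 hr1)
  have hR0 : 0 < R := by linarith
  have hrR : r * R < 1 := by
    have := mul_lt_mul_of_pos_left hR2 hr0
    rwa [mul_inv_cancel₀ hr0.ne'] at this
  have hrR0 : 0 < r * R := by positivity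
  refine ⟨R, hR1, fun u => ?_⟩
  have hs0 : Summable fun n : ℕ => C * (r * R) ^ n :=
    (summable_geometric_of_lt_one hrR0.le hrR).mul_left C
  have hs1 : Summable fun n : ℕ => C * (n * (r * R) ^ n) := by
    have := summable_pow_mul_geometric_of_norm_lt_one 1 (r := r * R)
      (by rwa [Real.norm_of_nonneg hrR0.le])
    simp only [pow_one] at this
    exact this.mul_left C
  have hb0 : ∀ (n : ℕ) (y : ℝ), y ∈ Metric.ball (0 : ℝ) R →
      ‖firstPassageProb G u v n * y ^ n‖ ≤ C * (r * R) ^ n := by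
    intro n y hy
    rw [mem_ball_zero_iff] at hy
    rw [norm_mul, norm_pow, Real.norm_of_nonneg (firstPassageProb_nonneg G u v n), mul_pow,
      ← mul_assoc]
    exact mul_le_mul (hdecay u n) (pow_le_pow_left₀ (norm_nonneg y) hy.le n) (by positivity)
      (by positivity)
  have hb1 : ∀ (n : ℕ) (y : ℝ), y ∈ Metric.ball (0 : ℝ) R →
      ‖firstPassageProb G u v n * (n * y ^ (n - 1))‖ ≤ C * (n * (r * R) ^ n) := by
    intro n y hy
    rw [mem_ball_zero_iff] at hy
    rw [norm_mul, norm_mul, norm_pow, Real.norm_of_nonneg (firstPassageProb_nonneg G u v n),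
      RCLike.norm_natCast, mul_pow]
    have h1 : ‖y‖ ^ (n - 1) ≤ R ^ n :=
      (pow_le_pow_left₀ (norm_nonneg y) hy.le _).trans
        (pow_le_pow_right₀ hR1.le (Nat.sub_le n 1))
    calc firstPassageProb G u v n * (n * ‖y‖ ^ (n - 1))
        ≤ (C * r ^ n) * (n * R ^ n) :=
          mul_le_mul (hdecay u n) (mul_le_mul_of_nonneg_left h1 (by positivity)) (by positivity)
            (by positivity)
      _ = C * (n * (r ^ n * R ^ n)) := by ring
  have hsum : ∀ y ∈ Metric.ball (0 : ℝ) R,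
      Summable fun n : ℕ => firstPassageProb G u v n * y ^ n :=
    fun y hy => Summable.of_norm_bounded hs0 fun n => hb0 n y hy
  intro z hz
  refine ⟨hsum z hz, Summable.of_norm_bounded hs1 fun n => hb1 n z hz, ?_⟩
  exact hasDerivAt_tsum_of_isPreconnected hs1 Metric.isOpen_ball
    (convex_ball (0 : ℝ) R).isPreconnected
    (fun n y _ => (hasDerivAt_pow n y).const_mul _) hb1 hz (hsum z hz) hz

theorem IsHittingFunction.eventually_summable (hh : IsHittingFunction G v h) (u : V) :
    ∀ᶠ z in 𝓝 (1 : ℝ), Summable fun n : ℕ => firstPassageProb G u v n * z ^ n := by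
  obtain ⟨R, hR, hball⟩ := hh.hasDerivAt_aux
  filter_upwards [Metric.isOpen_ball.mem_nhds
    (show (1 : ℝ) ∈ Metric.ball (0 : ℝ) R by simpa using hR)] with z hz
  exact (hball u z hz).1

theorem IsHittingFunction.hasDerivAt (hh : IsHittingFunction G v h) (u : V) :
    (Summable fun n : ℕ => firstPassageProb G u v n) ∧
      (Summable fun n : ℕ => firstPassageProb G u v n * n) ∧
      HasDerivAt (passageGenFun G u v) (∑' n : ℕ, firstPassageProb G u v n * n) 1 := by
  obtain ⟨R, hR, hball⟩ := hh.hasDerivAt_aux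
  simpa using hball u 1 (by simpa using hR)

theorem sum_stepProb {u : V} (hu : realDegree G u ≠ 0) : ∑ w, stepProb G u w = 1 := by
  have h : ∀ w, stepProb G u w = (if G.Adj u w then 1 else 0) * (1 / realDegree G u) := by
    intro w
    rw [stepProb_eq, ite_mul, one_mul, zero_mul]
  rw [Finset.sum_congr rfl fun w _ => h w, ← Finset.sum_mul]
  exact mul_one_div_cancel hu

/-- Simple random walk almost surely reaches `v`. -/
theorem IsHittingFunction.tsum_firstPassageProb (hh : IsHittingFunction G v h)
    (hdeg : ∀ u, realDegree G u ≠ 0) (u : V) : ∑' n, firstPassageProb G u v n = 1 := by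
  -- The probability of never reaching v vanishes at v and is harmonic elsewhere.
  have := hh.eq_zero_of_harmonic (g := fun u => 1 - ∑' n, firstPassageProb G u v n) ?_ ?_ u
  · linarith
  · rw [(hh.hasDerivAt v).1.tsum_eq_zero_add]
    simp [firstPassageProb_zero, firstPassageProb_self_succ]
  · intro u hu
    rw [(hh.hasDerivAt u).1.tsum_eq_zero_add]
    simp only [firstPassageProb_zero, firstPassageProb_succ, if_neg hu, mul_sub, mul_one,
      Finset.sum_sub_distrib, sum_stepProb (hdeg u), zero_add]
    rw [Summable.tsum_finsetSum fun w _ => (hh.hasDerivAt w).1.mul_left _]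
    simp only [tsum_mul_left]

/-- The hitting time is the unique solution of its one-step equations. -/
theorem IsHittingFunction.hittingTime_eq (hh : IsHittingFunction G v h)
    (hdeg : ∀ u, realDegree G u ≠ 0) (u : V) : hittingTime G u v = h u := by
  rw [hittingTime, (hh.hasDerivAt u).2.2.deriv]
  have := hh.eq_zero_of_harmonic
    (g := fun u => (∑' n : ℕ, firstPassageProb G u v n * n) - h u) ?_ ?_ u
  · linarith
  · rw [(hh.hasDerivAt v).2.1.tsum_eq_zero_add]
    simp [firstPassageProb_self_succ, hh.self]
  · intro u hu
    rw [(hh.hasDerivAt u).2.1.tsum_eq_zero_add, hh.step u hu]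
    simp only [firstPassageProb_succ, if_neg hu, mul_sub, Finset.sum_sub_distrib,
      Nat.cast_zero, mul_zero, zero_add]
    -- The factor n + 1 splits into the remaining time n and the first step; the latter sums to 1
    -- because v is reached almost surely.
    have h1 : ∀ n : ℕ, (∑ w, stepProb G u w * firstPassageProb G w v n) * ((n + 1 : ℕ) : ℝ) =
        ∑ w, stepProb G u w * (firstPassageProb G w v n * n + firstPassageProb G w v n) := by
      intro n
      rw [Finset.sum_mul]
      refine Finset.sum_congr rfl fun w _ => ?_
      push_cast
      ring
    have hs := fun w => (hh.hasDerivAt w).2.1.add (hh.hasDerivAt w).1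
    rw [tsum_congr h1, Summable.tsum_finsetSum fun w _ => (hs w).mul_left _]
    have h2 : ∀ w, ∑' n : ℕ, stepProb G u w *
          (firstPassageProb G w v n * n + firstPassageProb G w v n) =
        stepProb G u w * (∑' n : ℕ, firstPassageProb G w v n * n) + stepProb G u w := by
      intro w
      rw [tsum_mul_left, (hh.hasDerivAt w).2.1.tsum_add (hh.hasDerivAt w).1,
        hh.tsum_firstPassageProb hdeg w]
      ring
    simp only [h2, Finset.sum_add_distrib, sum_stepProb (hdeg u)]
    ring

end Decay

/-! ### Hitting times in trees -/

section Tree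

variable {V : Type u} [Fintype V] {G : SimpleGraph V}

theorem realDegree_pos [Nontrivial V] (hG : G.Connected) (u : V) : 0 < realDegree G u := by
  rw [realDegree_eq]
  exact_mod_cast hG.preconnected.degree_pos_of_nontrivial u

/-- The hitting time of `v` from `u` in a tree, in terms of distances. -/
def treeHitting (G : SimpleGraph V) (v u : V) : ℝ :=
  ∑ x, realDegree G x / 2 * ((G.dist u v : ℝ) + G.dist x v - G.dist u x)

/-- Away from v the terms deg − 2 of d(·, v) and d(·, x) cancel, leaving only the point mass −2 at
x, weighted by deg(x)/2. -/
theorem laplacian_treeHitting (hG : G.IsTree) {u v : V} (huv : u ≠ v) :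
    laplacian G (treeHitting G v) u = -realDegree G u := by
  have h0 : ∀ x, laplacian G (fun _ => (G.dist x v : ℝ)) u = 0 := by
    intro x
    simp [laplacian]
  unfold treeHitting
  rw [laplacian_sum]
  simp only [laplacian_const_mul, laplacian_sub, laplacian_add, laplacian_dist hG, h0, if_neg huv]
  simp

theorem isHittingFunction_treeHitting [Nontrivial V] (hG : G.IsTree) (v : V) :
    IsHittingFunction G v (treeHitting G v) where
  nonneg u := Finset.sum_nonneg fun x _ => by
    have h1 : (G.dist u x : ℝ) ≤ G.dist u v + G.dist v x := by
      exact_mod_cast hG.1.dist_triangle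
    rw [SimpleGraph.dist_comm (u := v)] at h1
    have h2 := realDegree_pos hG.1 x
    exact mul_nonneg (by positivity) (by linarith)
  self := by
    refine Finset.sum_eq_zero fun x _ => ?_
    rw [SimpleGraph.dist_comm (u := x)]
    simp
  step u hu := by
    have h := laplacian_treeHitting hG hu
    have hd := (realDegree_pos hG.1 u).ne'
    have h1 : ∑ w, stepProb G u w * treeHitting G v w =
        treeHitting G v u + laplacian G (treeHitting G v) u / realDegree G u := by
      rw [← one_mul (treeHitting G v u), ← sum_stepProb hd, laplacian, Finset.sum_mul,
        Finset.sum_div, ← Finset.sum_add_distrib]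
      refine Finset.sum_congr rfl fun w _ => ?_
      rw [stepProb_eq]
      split_ifs
      · field_simp
        ring
      · simp
    rw [h1, h, neg_div, div_self hd]
    ring

theorem hittingTime_eq_treeHitting [Nontrivial V] (hG : G.IsTree) (u v : V) :
    hittingTime G u v = treeHitting G v u :=
  (isHittingFunction_treeHitting hG v).hittingTime_eq (fun x => (realDegree_pos hG.1 x).ne') u

theorem sum_hittingTime [Nontrivial V] (hG : G.IsTree) :
    ∑ u, ∑ v, hittingTime G u v = 2 * wienerIndex G * ((Fintype.card V : ℝ) - 1) := by
  simp only [hittingTime_eq_treeHitting hG, treeHitting]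
  -- For fixed x the last two distance terms cancel after summing over u and v, leaving deg(x)/2 ·
  -- 2W.
  have h1 : ∀ x, ∑ u, ∑ v, realDegree G x / 2 *
      ((G.dist u v : ℝ) + G.dist x v - G.dist u x) = realDegree G x * wienerIndex G := by
    intro x
    have h2 : ∑ u, (G.dist u x : ℝ) = ∑ v, (G.dist x v : ℝ) :=
      Finset.sum_congr rfl fun u _ => by rw [SimpleGraph.dist_comm]
    simp only [← Finset.mul_sum, Finset.sum_sub_distrib, Finset.sum_add_distrib,
      ← two_mul_wienerIndex, Finset.sum_const, Finset.card_univ, nsmul_eq_mul, h2]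
    ring
  have h3 : ∀ u, ∑ v, ∑ x, realDegree G x / 2 *
      ((G.dist u v : ℝ) + G.dist x v - G.dist u x) =
      ∑ x, ∑ v, realDegree G x / 2 * ((G.dist u v : ℝ) + G.dist x v - G.dist u x) :=
    fun u => Finset.sum_comm
  simp only [h3]
  rw [Finset.sum_comm]
  simp only [h1, ← Finset.sum_mul, sum_realDegree_of_isTree hG]
  ring

/-- In a tree, the mean hitting time is proportional to the Wiener index. -/
theorem two_mul_wienerIndex_eq [Nontrivial V] (hG : G.IsTree) :
    2 * wienerIndex G = (Fintype.card V : ℝ) * meanHittingTime G := by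
  have h1 : (1 : ℝ) < Fintype.card V := by exact_mod_cast Fintype.one_lt_card
  have h2 : (Fintype.card V : ℝ) - 1 ≠ 0 := by linarith
  have h3 : (Fintype.card V : ℝ) ≠ 0 := by linarith
  rw [meanHittingTime, sum_hittingTime hG]
  field_simp

end Tree

/-! ### Adjacency, degrees and tree structure of the grown graph -/

section Growth

variable {V : Type u} (G : SimpleGraph V)

@[simp]
theorem growGraph_adj_inl_inl (v w : V) : ¬(growGraph G).Adj (.inl v) (.inl w) := by
  simp [growGraph, growRel]

@[simp]
theorem growGraph_adj_inl_mid (v : V) (d : G.Dart) :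
    (growGraph G).Adj (.inl v) (.inr (.inl d)) ↔ d.fst = v := by
  simp [growGraph, growRel]

@[simp]
theorem growGraph_adj_inl_leaf (v : V) (d : G.Dart) :
    (growGraph G).Adj (.inl v) (.inr (.inr d)) ↔ d.fst = v := by
  simp [growGraph, growRel]

@[simp]
theorem growGraph_adj_mid_inl (v : V) (d : G.Dart) :
    (growGraph G).Adj (.inr (.inl d)) (.inl v) ↔ d.fst = v := by
  simp [growGraph, growRel]

@[simp]
theorem growGraph_adj_leaf_inl (v : V) (d : G.Dart) :
    (growGraph G).Adj (.inr (.inr d)) (.inl v) ↔ d.fst = v := by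
  simp [growGraph, growRel]

@[simp]
theorem growGraph_adj_mid_mid (d e : G.Dart) :
    (growGraph G).Adj (.inr (.inl d)) (.inr (.inl e)) ↔ e = d.symm := by
  simp only [growGraph, growRel, SimpleGraph.fromRel_adj]
  constructor
  · rintro ⟨-, h | h⟩
    · exact h
    · rw [h, SimpleGraph.Dart.symm_symm]
  · rintro rfl
    refine ⟨?_, Or.inl rfl⟩
    simpa using (SimpleGraph.Dart.symm_ne d).symm

@[simp]
theorem growGraph_adj_mid_leaf (d e : G.Dart) :
    ¬(growGraph G).Adj (.inr (.inl d)) (.inr (.inr e)) := by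
  simp [growGraph, growRel]

@[simp]
theorem growGraph_adj_leaf_mid (d e : G.Dart) :
    ¬(growGraph G).Adj (.inr (.inr d)) (.inr (.inl e)) := by
  simp [growGraph, growRel]

@[simp]
theorem growGraph_adj_leaf_leaf (d e : G.Dart) :
    ¬(growGraph G).Adj (.inr (.inr d)) (.inr (.inr e)) := by
  simp [growGraph, growRel]

variable {G} in
theorem growGraph_connected (hG : G.Connected) : (growGraph G).Connected := by
  have hadj : ∀ v w, G.Adj v w → (growGraph G).Reachable (.inl v) (.inl w) := by
    intro v w h
    let d : G.Dart := ⟨(v, w), h⟩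
    have h1 : (growGraph G).Adj (.inl v) (.inr (.inl d)) := by simp [d]
    have h2 : (growGraph G).Adj (.inr (.inl d)) (.inr (.inl d.symm)) := by simp
    have h3 : (growGraph G).Adj (.inr (.inl d.symm)) (.inl w) := by simp [d]
    exact h1.reachable.trans (h2.reachable.trans h3.reachable)
  have hold : ∀ v w, (growGraph G).Reachable (.inl v) (.inl w) := by
    intro v w
    obtain ⟨p⟩ := hG v w
    induction p with
    | nil => rfl
    | cons h _ ih => exact (hadj _ _ h).trans ih
  have hex : ∀ P : GrowVert G, ∃ v, (growGraph G).Reachable P (.inl v) := by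
    rintro (v | d | d)
    · exact ⟨v, SimpleGraph.Reachable.refl _⟩
    · exact ⟨d.fst, SimpleGraph.Adj.reachable (by simp)⟩
    · exact ⟨d.fst, SimpleGraph.Adj.reachable (by simp)⟩
  have := hG.nonempty
  refine ⟨fun P Q => ?_⟩
  obtain ⟨v, hv⟩ := hex P
  obtain ⟨w, hw⟩ := hex Q
  exact hv.trans ((hold v w).trans hw.symm)

variable [Fintype V]

theorem sum_growVert (F : GrowVert G → ℝ) :
    ∑ P, F P = ∑ v, F (.inl v) + (∑ d, F (.inr (.inl d)) + ∑ d, F (.inr (.inr d))) := by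
  rw [Fintype.sum_sum_type, Fintype.sum_sum_type]

theorem sum_adj_inl (F : GrowVert G → ℝ) (v : V) :
    (∑ P, if (growGraph G).Adj (.inl v) P then F P else 0) =
      (∑ d : G.Dart, if d.fst = v then F (.inr (.inl d)) else 0) +
        ∑ d : G.Dart, if d.fst = v then F (.inr (.inr d)) else 0 := by
  simp

theorem sum_adj_mid (F : GrowVert G → ℝ) (d : G.Dart) :
    (∑ P, if (growGraph G).Adj (.inr (.inl d)) P then F P else 0) =
      F (.inl d.fst) + F (.inr (.inl d.symm)) := by
  simp

theorem sum_adj_leaf (F : GrowVert G → ℝ) (d : G.Dart) :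
    (∑ P, if (growGraph G).Adj (.inr (.inr d)) P then F P else 0) = F (.inl d.fst) := by
  simp

theorem sum_dart_fst_eq (F : V → V → ℝ) (v : V) :
    (∑ d : G.Dart, if d.fst = v then F d.fst d.snd else 0) =
      ∑ w, if G.Adj v w then F v w else 0 := by
  rw [sum_dart G fun x y => if x = v then F x y else 0, Finset.sum_eq_single v]
  · simp
  · intro x _ hx
    simp [hx]
  · simp

theorem sum_dart_fst_eq_const (c : ℝ) (v : V) :
    (∑ d : G.Dart, if d.fst = v then c else 0) = realDegree G v * c := by
  rw [sum_dart_fst_eq G fun _ _ => c, realDegree, Finset.sum_mul]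
  simp only [ite_mul, one_mul, zero_mul]

theorem realDegree_grow_inl (v : V) :
    realDegree (growGraph G) (.inl v) = 2 * realDegree G v := by
  rw [realDegree, sum_adj_inl G fun _ => 1, sum_dart_fst_eq_const]
  ring

theorem realDegree_grow_mid (d : G.Dart) : realDegree (growGraph G) (.inr (.inl d)) = 2 := by
  rw [realDegree, sum_adj_mid G fun _ => 1]
  norm_num

theorem realDegree_grow_leaf (d : G.Dart) : realDegree (growGraph G) (.inr (.inr d)) = 1 := by
  rw [realDegree, sum_adj_leaf G fun _ => 1]

theorem sum_dart_fst (h : V → ℝ) : ∑ d : G.Dart, h d.fst = ∑ v, realDegree G v * h v := by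
  rw [sum_dart G fun x _ => h x]
  refine Finset.sum_congr rfl fun v _ => ?_
  simp only [realDegree, Finset.sum_mul, ite_mul, one_mul, zero_mul]

theorem sum_dart_snd (h : V → ℝ) : ∑ d : G.Dart, h d.snd = ∑ v, realDegree G v * h v := by
  rw [← sum_dart_fst, sum_dart G fun _ y => h y, sum_dart G fun x _ => h x,
    sum_adj_swap G fun _ y => h y]

variable {G} in
theorem card_dart (hG : G.IsTree) :
    (Fintype.card G.Dart : ℝ) = 2 * ((Fintype.card V : ℝ) - 1) := by
  have := sum_dart_fst G fun _ => 1
  simp only [mul_one, sum_realDegree_of_isTree hG] at this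
  rw [← this]
  simp

variable {G} in
theorem card_growVert (hG : G.IsTree) :
    (Fintype.card (GrowVert G) : ℝ) = 5 * ((Fintype.card V : ℝ) - 1) + 1 := by
  rw [Fintype.card_sum, Fintype.card_sum]
  push_cast
  rw [card_dart hG]
  ring

variable {G} in
-- Connectedness and an edge count by handshake: the degrees sum to (4 + 4 + 2)(N − 1), so there are
-- 5(N − 1) edges, one fewer than the vertices.
theorem growGraph_isTree (hG : G.IsTree) : (growGraph G).IsTree := by
  refine SimpleGraph.isTree_iff_connected_and_card.2 ⟨growGraph_connected hG.1, ?_⟩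
  have h := sum_realDegree (growGraph G)
  rw [sum_growVert] at h
  simp only [realDegree_grow_inl, realDegree_grow_mid, realDegree_grow_leaf, ← Finset.mul_sum,
    sum_realDegree_of_isTree hG, Finset.sum_const, Finset.card_univ, nsmul_eq_mul,
    card_dart hG] at h
  have hc := card_growVert hG
  rw [← Nat.card_eq_fintype_card (α := GrowVert G)] at hc
  have : ((Nat.card (growGraph G).edgeSet + 1 : ℕ) : ℝ) = Nat.card (GrowVert G) := by
    rw [hc]
    push_cast
    linarith
  exact_mod_cast this

end Growth

/-! ### Distances and Wiener index after one growth step -/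

section Distance

variable {V : Type u} (G : SimpleGraph V)

/-- Three times the piecewise linear extension of a function to the grown graph, constant on the
new leaf edges. -/
def interpolate (h : V → ℝ) : GrowVert G → ℝ
  | .inl v => 3 * h v
  | .inr (.inl d) => 2 * h d.fst + h d.snd
  | .inr (.inr d) => 3 * h d.fst

/-- The indicator of the new leaves. -/
def leafOffset : GrowVert G → ℝ
  | .inr (.inr _) => 1
  | _ => 0

/-- The error of the bilinear interpolation of the distance on the pairs of new vertices which
belong to the same edge. -/
def distCorrection : GrowVert G → GrowVert G → ℝ
  | .inr (.inl e), .inr (.inl d) =>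
      -- Tripled bilinear interpolation gives 4/3 at an inserted vertex paired with itself and 5/3
      -- for the two on one edge; the true distances are 0 and 1.
      4 / 3 * (if d = e then 1 else 0) + 2 / 3 * (if d = e.symm then 1 else 0)
  | .inr (.inr e), .inr (.inr d) => 2 * if d = e then 1 else 0
  | _, _ => 0

/-- The distance from a vertex `v` of a tree to a vertex of the grown tree, interpolated. -/
def interpolatedDist (Q : GrowVert G) (v : V) : ℝ :=
  1 / 3 * interpolate G (fun w => (G.dist v w : ℝ)) Q

/-- The distance in the grown tree, in terms of the distance in the tree. -/
def growDist (Q P : GrowVert G) : ℝ :=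
  interpolate G (interpolatedDist G Q) P + (leafOffset G P + leafOffset G Q)
    - distCorrection G Q P

theorem growDist_self (Q : GrowVert G) : growDist G Q Q = 0 := by
  rcases Q with w | e | e
  · simp [growDist, interpolate, interpolatedDist, leafOffset, distCorrection]
  · have h1 : G.dist e.fst e.snd = 1 := SimpleGraph.dist_eq_one_iff_adj.2 e.adj
    have h2 : G.dist e.snd e.fst = 1 := SimpleGraph.dist_eq_one_iff_adj.2 e.adj.symm
    have h3 : e ≠ e.symm := (SimpleGraph.Dart.symm_ne e).symm
    simp [growDist, interpolate, interpolatedDist, leafOffset, distCorrection, h1, h2, h3]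
    norm_num
  · simp [growDist, interpolate, interpolatedDist, leafOffset, distCorrection]
    norm_num

variable [Fintype V]

theorem laplacian_grow_inl (f : GrowVert G → ℝ) (v : V) :
    laplacian (growGraph G) f (.inl v) =
      (∑ d : G.Dart, if d.fst = v then f (.inr (.inl d)) - f (.inl v) else 0) +
        ∑ d : G.Dart, if d.fst = v then f (.inr (.inr d)) - f (.inl v) else 0 :=
  sum_adj_inl G (fun P => f P - f (.inl v)) v

theorem laplacian_grow_mid (f : GrowVert G → ℝ) (d : G.Dart) :
    laplacian (growGraph G) f (.inr (.inl d)) =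
      f (.inl d.fst) - f (.inr (.inl d)) + (f (.inr (.inl d.symm)) - f (.inr (.inl d))) :=
  sum_adj_mid G (fun P => f P - f (.inr (.inl d))) d

theorem laplacian_grow_leaf (f : GrowVert G → ℝ) (d : G.Dart) :
    laplacian (growGraph G) f (.inr (.inr d)) = f (.inl d.fst) - f (.inr (.inr d)) :=
  sum_adj_leaf G (fun P => f P - f (.inr (.inr d))) d

/-- Each third of an edge carries a third of the tripled increment, and leaf edges carry none. -/
theorem laplacian_interpolate_inl (h : V → ℝ) (v : V) :
    laplacian (growGraph G) (interpolate G h) (.inl v) = laplacian G h v := by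
  rw [laplacian_grow_inl, laplacian, ← sum_dart_fst_eq G fun x y => h y - h x,
    ← Finset.sum_add_distrib]
  refine Finset.sum_congr rfl fun d _ => ?_
  split_ifs with hd
  · simp only [interpolate, hd]
    ring
  · ring

theorem laplacian_interpolate_mid (h : V → ℝ) (d : G.Dart) :
    laplacian (growGraph G) (interpolate G h) (.inr (.inl d)) = 0 := by
  rw [laplacian_grow_mid]
  simp only [interpolate, SimpleGraph.Dart.symm, Prod.fst_swap, Prod.snd_swap]
  ring

theorem laplacian_interpolate_leaf (h : V → ℝ) (d : G.Dart) :
    laplacian (growGraph G) (interpolate G h) (.inr (.inr d)) = 0 := by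
  rw [laplacian_grow_leaf]
  simp [interpolate]

variable {G}

theorem laplacian_interpolatedDist (hG : G.IsTree) (Q : GrowVert G) (v : V) :
    laplacian G (interpolatedDist G Q) v = realDegree G v - 2 +
      2 / 3 * interpolate G (fun w => if v = w then 1 else 0) Q := by
  unfold interpolatedDist
  rw [laplacian_const_mul]
  rcases Q with w | e | e <;>
    simp only [interpolate, laplacian_add, laplacian_const_mul, laplacian_dist hG] <;> ring

theorem sum_dart_eq (e : G.Dart) (v : V) :
    (∑ d : G.Dart, if d.fst = v then (if d = e then (1 : ℝ) else 0) else 0) =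
      if v = e.fst then 1 else 0 := by
  rw [Finset.sum_eq_single e]
  · simp [eq_comm]
  · intro d _ hd
    simp [hd]
  · simp

/-- The leaf offset accounts for the doubled degrees at old vertices and for −1 at leaves. When Q is
new, interpolation spreads its point mass over old vertices; `distCorrection` moves it back to Q. -/
theorem laplacian_growDist (hG : G.IsTree) (Q P : GrowVert G) :
    laplacian (growGraph G) (growDist G Q) P =
      realDegree (growGraph G) P - 2 + 2 * if P = Q then 1 else 0 := by
  unfold growDist
  rw [laplacian_sub, laplacian_add, laplacian_add]
  have hconst : laplacian (growGraph G) (fun _ => leafOffset G Q) P = 0 := by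
    simp [laplacian]
  rw [hconst]
  rcases P with v | d | d
  · rw [laplacian_interpolate_inl, laplacian_interpolatedDist hG, realDegree_grow_inl]
    have h1 : laplacian (growGraph G) (leafOffset G) (.inl v) = realDegree G v := by
      rw [laplacian_grow_inl]
      simp only [leafOffset, sub_zero, sum_dart_fst_eq_const]
      ring
    rw [h1, laplacian_grow_inl]
    rcases Q with w | e | e
    · simp only [distCorrection, interpolate, Sum.inl.injEq]
      simp
      ring
    · have h2 : e.symm.fst = e.snd := rfl
      simp only [distCorrection, interpolate, sub_zero, reduceCtorEq, if_false,
        ← mul_ite_zero, ite_add_zero, Finset.sum_add_distrib, ← Finset.mul_sum, sum_dart_eq, h2,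
        ite_self, Finset.sum_const_zero]
      split_ifs <;> ring
    · simp only [distCorrection, interpolate, sub_zero, reduceCtorEq, if_false,
        ← mul_ite_zero, ← Finset.mul_sum, sum_dart_eq]
      simp
      ring
  · rw [laplacian_interpolate_mid, realDegree_grow_mid, laplacian_grow_mid, laplacian_grow_mid]
    rcases Q with w | e | e
    · simp [distCorrection, leafOffset]
    · have h1 : d.symm = e ↔ d = e.symm :=
        ⟨fun h => by rw [← h, d.symm_symm], fun h => by rw [h, e.symm_symm]⟩
      have h2 : d.symm = e.symm ↔ d = e :=
        SimpleGraph.Dart.symm_involutive.injective.eq_iff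
      simp only [distCorrection, leafOffset, h1, h2, Sum.inr.injEq, Sum.inl.injEq]
      ring
    · simp [distCorrection, leafOffset]
  · rw [laplacian_interpolate_leaf, realDegree_grow_leaf, laplacian_grow_leaf,
      laplacian_grow_leaf]
    rcases Q with w | e | e
    · simp [distCorrection, leafOffset]
      norm_num
    · simp [distCorrection, leafOffset]
      norm_num
    · simp only [distCorrection, leafOffset, Sum.inr.injEq]
      ring

/-- The distance in the grown tree. -/
theorem dist_growGraph (hG : G.IsTree) (P Q : GrowVert G) :
    ((growGraph G).dist P Q : ℝ) = growDist G Q P := by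
  refine eq_of_laplacian_eq (growGraph_connected hG.1)
    (f := fun P => ((growGraph G).dist P Q : ℝ)) (fun P => ?_) Q ?_ P
  · rw [laplacian_dist (growGraph_isTree hG), laplacian_growDist hG]
    split_ifs <;> rfl
  · simp [growDist_self]

variable (G) in
theorem sum_interpolate (h : V → ℝ) :
    ∑ P, interpolate G h P = 3 * ∑ v, h v + 6 * ∑ v, realDegree G v * h v := by
  simp only [sum_growVert, interpolate, Finset.sum_add_distrib, ← Finset.mul_sum, sum_dart_fst,
    sum_dart_snd]
  ring

variable (G) in
theorem sum_leafOffset : ∑ P, leafOffset G P = Fintype.card G.Dart := by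
  simp [leafOffset]

variable (G) in
theorem sum_distCorrection :
    ∑ Q, ∑ P, distCorrection G Q P = 4 * Fintype.card G.Dart := by
  simp only [sum_growVert, distCorrection, Finset.sum_add_distrib, ← Finset.mul_sum,
    Finset.sum_ite_eq', Finset.mem_univ, if_true, Finset.sum_const, Finset.card_univ,
    nsmul_eq_mul]
  ring

theorem sum_interpolatedDist (v : V) :
    ∑ Q, interpolatedDist G Q v =
      ∑ w, (G.dist v w : ℝ) + 2 * ∑ w, realDegree G w * (G.dist w v : ℝ) := by
  simp only [interpolatedDist, ← Finset.mul_sum, sum_interpolate, SimpleGraph.dist_comm (u := v)]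
  ring

/-- The Wiener index of the grown tree. -/
theorem wienerIndex_growGraph (hG : G.IsTree) :
    wienerIndex (growGraph G) = 75 * wienerIndex G -
      20 * (((Fintype.card V : ℝ) - 1) ^ 2 + ((Fintype.card V : ℝ) - 1)) := by
  have h := two_mul_wienerIndex (G := growGraph G)
  rw [Finset.sum_comm] at h
  simp only [dist_growGraph hG] at h
  have h1 : ∑ Q, ∑ P, interpolate G (interpolatedDist G Q) P =
      3 * ∑ v, ∑ Q, interpolatedDist G Q v +
        6 * ∑ v, realDegree G v * ∑ Q, interpolatedDist G Q v := by
    simp only [sum_interpolate, Finset.sum_add_distrib, ← Finset.mul_sum]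
    rw [Finset.sum_comm, Finset.sum_comm (f := fun Q v => realDegree G v * _)]
    simp only [Finset.mul_sum]
  have h2 : ∑ v, realDegree G v * ∑ w, (G.dist v w : ℝ) =
      4 * wienerIndex G - (Fintype.card V : ℝ) * ((Fintype.card V : ℝ) - 1) := by
    rw [← sum_realDegree_dist hG, Finset.sum_comm]
    exact Finset.sum_congr rfl fun v _ => Finset.mul_sum _ _ _
  simp only [growDist, Finset.sum_sub_distrib, Finset.sum_add_distrib, h1, sum_interpolatedDist,
    sum_leafOffset, sum_distCorrection, mul_add, mul_left_comm (realDegree G _) (2 : ℝ),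
    ← Finset.mul_sum, sum_realDegree_dist hG, sum_realDegree_realDegree_dist hG, h2,
    ← two_mul_wienerIndex, Finset.sum_const, Finset.card_univ, nsmul_eq_mul] at h
  rw [card_growVert hG, card_dart hG] at h
  linarith

end Distance

/-! ### Solving the recursion in t -/

section GrownTree

variable {V : Type u} [Fintype V] {G : SimpleGraph V}

/-- The structure, the order and the Wiener index of the grown trees. -/
theorem grownTree_spec (hG : G.IsTree) (t : ℕ) :
    (grownTree G t).graph.IsTree ∧
      (order G t : ℝ) = 5 ^ t * ((Fintype.card V : ℝ) - 1) + 1 ∧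
      wienerIndex (grownTree G t).graph = 75 ^ t * wienerIndex G
        - 4 * 5 ^ t * ((15 ^ t - 5 ^ t) / 10 * ((Fintype.card V : ℝ) - 1) ^ 2
          + (15 ^ t - 1) / 14 * ((Fintype.card V : ℝ) - 1)) := by
  induction t with
  | zero =>
    refine ⟨hG, ?_, ?_⟩
    · simp [order, grownTree]
      rfl
    · simp [grownTree]
      rfl
  | succ t ih =>
    obtain ⟨ih1, ih2, ih3⟩ := ih
    have h1 : (Fintype.card (grownTree G t).V : ℝ) - 1 = 5 ^ t * ((Fintype.card V : ℝ) - 1) := by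
      rw [order] at ih2
      rw [ih2]
      ring
    refine ⟨growGraph_isTree ih1, ?_, ?_⟩
    · refine (card_growVert ih1).trans ?_
      rw [h1]
      ring
    · refine (wienerIndex_growGraph ih1).trans ?_
      -- Factoring 75^t leaves only powers of 15 and 5, in which the solved recursion is a
      -- polynomial identity.
      have h75 : (75 : ℝ) ^ t = 15 ^ t * 5 ^ t := by
        rw [← mul_pow]
        norm_num
      rw [h1, ih3, pow_succ (75 : ℝ), h75]
      ring

variable [Nontrivial V]

theorem nontrivial_grownTree (hG : G.IsTree) (t : ℕ) : Nontrivial (grownTree G t).V := by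
  have h := (grownTree_spec hG t).2.1
  have h1 : (1 : ℝ) < Fintype.card V := by exact_mod_cast Fintype.one_lt_card
  have h2 : (0 : ℝ) < 5 ^ t * ((Fintype.card V : ℝ) - 1) :=
    mul_pos (by positivity) (by linarith)
  rw [← Fintype.one_lt_card_iff_nontrivial]
  have h3 : (1 : ℝ) < order G t := by linarith
  exact_mod_cast h3

theorem meanHittingTime_grownTree (hG : G.IsTree) (t : ℕ) :
    meanHittingTime (grownTree G t).graph
      = 2 / (5 ^ t * ((Fintype.card V : ℝ) - 1) + 1) *
          (75 ^ t * wienerIndex G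
            - 4 * 5 ^ t * ((15 ^ t - 5 ^ t) / 10 * ((Fintype.card V : ℝ) - 1) ^ 2
                + (15 ^ t - 1) / 14 * ((Fintype.card V : ℝ) - 1))) := by
  obtain ⟨h1, h2, h3⟩ := grownTree_spec hG t
  have := nontrivial_grownTree hG t
  have h4 := two_mul_wienerIndex_eq h1
  rw [show (Fintype.card (grownTree G t).V : ℝ) = _ from h2] at h4
  rw [← h3, div_mul_eq_mul_div, h4, mul_div_cancel_left₀]
  have h5 : (1 : ℝ) < Fintype.card V := by exact_mod_cast Fintype.one_lt_card
  have h6 : (0 : ℝ) < 5 ^ t * ((Fintype.card V : ℝ) - 1) :=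
    mul_pos (by positivity) (by linarith)
  linarith

end GrownTree

/-! ### The scaling exponent -/

section Asymptotics

theorem five_pow_rpow (t : ℕ) : ((5 : ℝ) ^ t) ^ (1 + Real.log 3 / Real.log 5) = 15 ^ t := by
  have h5 : Real.log 5 ≠ 0 := (Real.log_pos (by norm_num)).ne'
  have h : (5 : ℝ) ^ (1 + Real.log 3 / Real.log 5) = 15 := by
    rw [Real.rpow_add (by norm_num), Real.rpow_one, Real.rpow_def_of_pos (by norm_num),
      mul_div_cancel₀ _ h5, Real.exp_log (by norm_num)]
    norm_num
  rw [← Real.rpow_natCast, ← Real.rpow_mul (by norm_num), mul_comm, Real.rpow_mul (by norm_num),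
    h, Real.rpow_natCast]

/-- Since (5^t)^χ = 15^t, cancelling the powers leaves geometric terms in 1/3, 1/5 and 1/15; the
constants 2/5 and 2/7 are 4/10 and 4/14. -/
theorem tendsto_growth {E W : ℝ} (hE : 0 < E) :
    Tendsto (fun t : ℕ => 2 / (5 ^ t * E + 1) *
        (75 ^ t * W - 4 * 5 ^ t * ((15 ^ t - 5 ^ t) / 10 * E ^ 2 + (15 ^ t - 1) / 14 * E)) /
        (5 ^ t * E + 1) ^ (1 + Real.log 3 / Real.log 5)) atTop
      (𝓝 (2 / E * (W - 2 / 5 * E ^ 2 - 2 / 7 * E) / E ^ (1 + Real.log 3 / Real.log 5))) := by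
  have hpow : ∀ r : ℝ, 0 ≤ r → r < 1 → Tendsto (fun t : ℕ => r ^ t) atTop (𝓝 0) :=
    fun r h0 h1 => tendsto_pow_atTop_nhds_zero_of_lt_one h0 h1
  have ha := hpow (1 / 5) (by norm_num) (by norm_num)
  have hb := hpow (1 / 3) (by norm_num) (by norm_num)
  have hc := hpow (1 / 15) (by norm_num) (by norm_num)
  have hN : Tendsto (fun t : ℕ => E + (1 / 5 : ℝ) ^ t) atTop (𝓝 E) := by
    simpa using tendsto_const_nhds.add ha
  have hW : Tendsto (fun t : ℕ => W - 2 / 5 * (1 - (1 / 3 : ℝ) ^ t) * E ^ 2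
      - 2 / 7 * (1 - (1 / 15 : ℝ) ^ t) * E) atTop (𝓝 (W - 2 / 5 * E ^ 2 - 2 / 7 * E)) := by
    have h1 := ((hb.const_sub 1).const_mul (2 / 5)).mul_const (E ^ 2)
    have h2 := ((hc.const_sub 1).const_mul (2 / 7)).mul_const E
    simpa using (h1.const_sub W).sub h2
  have hlim := (((tendsto_const_nhds (x := (2 : ℝ))).div hN hE.ne').mul hW).div
    (hN.rpow_const (p := 1 + Real.log 3 / Real.log 5) (Or.inl hE.ne'))
    (Real.rpow_pos_of_pos hE _).ne'
  refine hlim.congr fun t => ?_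
  have hpos : 0 < E + (1 / 5 : ℝ) ^ t := by positivity
  have hfac : (5 : ℝ) ^ t * E + 1 = 5 ^ t * (E + (1 / 5) ^ t) := by
    rw [mul_add, ← mul_pow]
    norm_num
  simp only [Pi.div_apply]
  rw [hfac, Real.mul_rpow (by positivity) hpos.le, five_pow_rpow]
  generalize (E + (1 / 5 : ℝ) ^ t) ^ (1 + Real.log 3 / Real.log 5) = X
  have h75 : (75 : ℝ) ^ t = 3 ^ t * 5 ^ t * 5 ^ t := by
    rw [← mul_pow, ← mul_pow]
    norm_num
  have h15 : (15 : ℝ) ^ t = 3 ^ t * 5 ^ t := by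
    rw [← mul_pow]
    norm_num
  have h15' : (1 / 15 : ℝ) ^ t = 1 / (3 ^ t * 5 ^ t) := by
    rw [← h15, one_div_pow]
  have hY : E + (1 / 5 : ℝ) ^ t ≠ 0 := hpos.ne'
  generalize E + (1 / 5 : ℝ) ^ t = Y at hY
  rw [h75, h15, h15', one_div_pow]
  have h3 : (3 : ℝ) ^ t ≠ 0 := by positivity
  have h5 : (5 : ℝ) ^ t ≠ 0 := by positivity
  generalize (3 : ℝ) ^ t = a at h3
  generalize (5 : ℝ) ^ t = b at h5
  -- Once X is generalised its positivity is lost; for X = 0 both sides are divisions by zero, hence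
  -- 0.
  by_cases hX : X = 0
  · simp [hX]
  field_simp
  ring

end Asymptotics

end

end TreeWalk

theorem mainTheorem1 {V : Type u} [Fintype V] [Nontrivial V]
    (T₀ : SimpleGraph V) (hT₀ : T₀.IsTree) :
    (∀ t : ℕ,
      (TreeWalk.grownTree T₀ t).graph.IsTree ∧
      (TreeWalk.order T₀ t : ℝ) = 5 ^ t * ((Fintype.card V : ℝ) - 1) + 1 ∧
      -- the hitting times are given by genuine derivatives of convergent power series
      (∀ u v : (TreeWalk.grownTree T₀ t).V,
        (∀ᶠ z in 𝓝 (1 : ℝ), Summable fun n : ℕ =>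
          TreeWalk.firstPassageProb (TreeWalk.grownTree T₀ t).graph u v n * z ^ n) ∧
        DifferentiableAt ℝ (TreeWalk.passageGenFun (TreeWalk.grownTree T₀ t).graph u v) 1) ∧
      2 * TreeWalk.wienerIndex (TreeWalk.grownTree T₀ t).graph
        = (TreeWalk.order T₀ t : ℝ) *
            TreeWalk.meanHittingTime (TreeWalk.grownTree T₀ t).graph ∧
      TreeWalk.meanHittingTime (TreeWalk.grownTree T₀ t).graph
        = 2 / (5 ^ t * ((Fintype.card V : ℝ) - 1) + 1) *
            (75 ^ t * TreeWalk.wienerIndex T₀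
              - 4 * 5 ^ t *
                ((15 ^ t - 5 ^ t) / 10 * ((Fintype.card V : ℝ) - 1) ^ 2
                  + (15 ^ t - 1) / 14 * ((Fintype.card V : ℝ) - 1)))) ∧
    ∃ c : ℝ, 0 < c ∧
      Tendsto
        (fun t : ℕ => TreeWalk.meanHittingTime (TreeWalk.grownTree T₀ t).graph /
          (TreeWalk.order T₀ t : ℝ) ^ (1 + Real.log 3 / Real.log 5))
        atTop (𝓝 c) := by
  refine ⟨fun t => ?_, ?_⟩
  · obtain ⟨h1, h2, -⟩ := TreeWalk.grownTree_spec hT₀ t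
    have := TreeWalk.nontrivial_grownTree hT₀ t
    refine ⟨h1, h2, fun u v => ?_, TreeWalk.two_mul_wienerIndex_eq h1,
      TreeWalk.meanHittingTime_grownTree hT₀ t⟩
    have hh := TreeWalk.isHittingFunction_treeHitting h1 v
    exact ⟨hh.eventually_summable u, (hh.hasDerivAt u).2.2.differentiableAt⟩
  · have h2 : (2 : ℝ) ≤ Fintype.card V := by
      exact_mod_cast Nat.succ_le_of_lt (Fintype.one_lt_card (α := V))
    have hW := TreeWalk.sq_card_sub_one_le_wienerIndex hT₀
    simp only [TreeWalk.meanHittingTime_grownTree hT₀, (TreeWalk.grownTree_spec hT₀ _).2.1]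
    have hE : 1 ≤ (Fintype.card V : ℝ) - 1 := by linarith
    generalize (Fintype.card V : ℝ) - 1 = E at hE hW
    have hE0 : 0 < E := by linarith
    refine ⟨_, ?_, TreeWalk.tendsto_growth hE0⟩
    -- From W ≥ E² and E ≤ E² the quantity is at least (1 − 24/35) E².
    have : 0 < TreeWalk.wienerIndex T₀ - 2 / 5 * E ^ 2 - 2 / 7 * E := by nlinarith
    have := Real.rpow_pos_of_pos hE0 (1 + Real.log 3 / Real.log 5)
    positivity
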